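/- Let $A\in\{0,1\}^{m\times n}$, let $b\in\mathbb{Z}_{\ge 0}^m$ be an integral constraint vector, $w\in\mathbb{R}^n$ and $X\in\mathbb{N}^n$. The packing LP is to maximize $w^Tx$ over all $x\in\mathbb{R}^n$ with $Ax\le b$ and $0\le x_v\le X_v$ for every $v$. Its factor graph is the bipartite graph with variable vertices $v\in\{1,\dots,n\}$, constraint vertices $C\in\{1,\dots,m\}$, and an edge $(v,C)$ whenever $A_{Cv}=1$; let $\mathcal{N}(\cdot)$ denote the set of neighbours. The min-sum packing algorithm with $t\in\mathbb{N}$ iterations is the following (a maximum over the empty set is $-\infty$). 1. Set $\mu^{(0)}_{C\to v}(\beta)=0$ for every edge $(v,C)$ and $\beta\in\{0,\dots,X_v\}$. 2. For $t'=1,\dots,t$, for every edge $(v,C)$ and $\beta\in\{0,\dots,X_v\}$, set $$\mu^{(t')}_{v\to C}(\beta)=w_v\beta+\sum_{C'\in\mathcal{N}(v)\setminus\{C\}}\mu^{(t'-1)}_{C'\to v}(\beta),$$ and then $$\mu^{(t')}_{C\to v}(\beta)=\max\Big\{\sum_{u\in\mathcal{N}(C)\setminus\{v\}}\mu^{(t')}_{u\to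 C}(z_u)\ :\ z\in\prod_u\{0,\dots,X_u\},\ z_v=\beta,\ \sum_{u\in\mathcal{N}(C)}z_u\le b_C\Big\}.$$ 3. For every $v$ let $\mu_v(\beta)=w_v\beta+\sum_{C\in\mathcal{N}(v)}\mu^{(t)}_{C\to v}(\beta)$, and let $\delta_{v,t}$ be the set of $\beta\in\{0,\dots,X_v\}$ that maximize $\mu_v(\beta)$. The output is $\hat{x}_v=\max\delta_{v,t}$ if $t$ is even and $\hat{x}_v=\min\delta_{v,t}$ if $t$ is odd. **Corollary.** If $x$ is an optimal solution of the packing LP and $x_r$ is not an integer, then for every $t\in\mathbb{N}$ the output $\hat{x}$ of the algorithm with $t$ iterations satisfies $\hat{x}_r\ge\lceil x_r\rceil$ if $t$ is even and $\hat{x}_r\le\lfloor x_r\rfloor$ if $t$ is odd. -/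

import Mathlib

noncomputable section

open scoped Matrix

/-- The data of a packing problem with variables indexed by `V` and constraints indexed by `C`:
a zero-one constraint matrix `A`, an integral constraint vector `b`, real weights `w`
and the upper bounds `X` of the variables. -/
structure PackingProblem (V C : Type*) where
  /-- the constraint matrix: rows are constraints, columns are variables -/
  A : Matrix C V ℕ
  zero_one : ∀ c v, A c v = 0 ∨ A c v = 1
  /-- the constraint vector -/
  b : C → ℕ
  /-- the weight vector -/
  w : V → ℝ
  /-- the domain boundary vector -/
  X : V → ℕ

/-- A factor graph model `⟨G, Ψ, Φ, X⟩`: a bipartite graph on the variable vertices `V` and the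
constraint vertices `C`, given by its edges; a factor function `ψ c` with values in `ℝ ∪ {-∞}`
for each constraint vertex; a variable function `φ v` for each variable vertex;
and the alphabet `{0, …, X v}` of each variable vertex. -/
structure FactorGraphModel (V C : Type*) where
  E : Finset (V × C)
  ψ : C → (V → ℕ) → WithBot ℝ
  φ : V → ℕ → ℝ
  X : V → ℕ

/-- The set of integral vectors `z` with `0 ≤ z v ≤ X v` for all `v`. -/
def zBox {V : Type*} [Fintype V] [DecidableEq V] (X : V → ℕ) : Finset (V → ℕ) :=
  Fintype.piFinset fun v => Finset.range (X v + 1)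

/-- The set of real vectors `x` with `0 ≤ x v ≤ X v` for all `v`. -/
def rBox {V : Type*} (X : V → ℕ) : Set (V → ℝ) :=
  {x | ∀ v, 0 ≤ x v ∧ x v ≤ (X v : ℝ)}

namespace FactorGraphModel

variable {V C : Type*} [Fintype V] [Fintype C] [DecidableEq V] [DecidableEq C]

/-- The constraint vertices adjacent to the variable vertex `v`. -/
def nbrV (M : FactorGraphModel V C) (v : V) : Finset C :=
  Finset.univ.filter fun c => (v, c) ∈ M.E

/-- The variable vertices adjacent to the constraint vertex `c`. -/
def nbrC (M : FactorGraphModel V C) (c : C) : Finset V :=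
  Finset.univ.filter fun v => (v, c) ∈ M.E

/-- The variable-to-constraint message `v → c`, computed from the constraint-to-variable
messages `μ` of the previous iteration. -/
def varMsg (M : FactorGraphModel V C) (μ : C → V → ℕ → WithBot ℝ)
    (v : V) (c : C) (β : ℕ) : WithBot ℝ :=
  ((M.φ v β : ℝ) : WithBot ℝ) + ∑ c' ∈ (M.nbrV v).erase c, μ c' v β

open Classical in
/-- The constraint-to-variable message `c → v`, computed from the variable-to-constraint
messages `ν` of the same iteration. A maximum over the empty set is `⊥`, that is `-∞`. -/
def conMsg (M : FactorGraphModel V C) (ν : V → C → ℕ → WithBot ℝ)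
    (c : C) (v : V) (β : ℕ) : WithBot ℝ :=
  ((zBox M.X).filter fun z => z v = β ∧ M.ψ c z = 0).sup
    fun z => ∑ u ∈ (M.nbrC c).erase v, ν u c (z u)

/-- The constraint-to-variable messages after `t` iterations, with zero initialization.
Only the values on edges `(v, c)` and at `β ≤ X v` matter. -/
def msg (M : FactorGraphModel V C) : ℕ → C → V → ℕ → WithBot ℝ
  | 0 => fun _ _ _ => 0
  | t + 1 => M.conMsg (M.varMsg (M.msg t))

/-- The final value computed by the variable vertex `v` for the assignment of `β` to `v`. -/
def finalValue (M : FactorGraphModel V C) (t : ℕ) (v : V) (β : ℕ) : WithBot ℝ :=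
  ((M.φ v β : ℝ) : WithBot ℝ) + ∑ c ∈ M.nbrV v, M.msg t c v β

/-- The largest final value at `v`. -/
def maxValue (M : FactorGraphModel V C) (t : ℕ) (v : V) : WithBot ℝ :=
  (Finset.range (M.X v + 1)).sup fun β => M.finalValue t v β

open Classical in
/-- The set of the values `β ∈ {0, …, X v}` that attain the largest final value at `v`. -/
def delta (M : FactorGraphModel V C) (t : ℕ) (v : V) : Finset ℕ :=
  (Finset.range (M.X v + 1)).filter fun β => M.finalValue t v β = M.maxValue t v

theorem delta_nonempty (M : FactorGraphModel V C) (t : ℕ) (v : V) : (M.delta t v).Nonempty := by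
  classical
  obtain ⟨β, hβ, h⟩ := Finset.exists_mem_eq_sup (Finset.range (M.X v + 1))
    ⟨0, by simp⟩ (fun β => M.finalValue t v β)
  exact ⟨β, by
    rw [delta, Finset.mem_filter]
    exact ⟨hβ, h.symm⟩⟩

/-- The output of the min-sum algorithm for packing after `t` iterations. -/
def minSumPacking (M : FactorGraphModel V C) (t : ℕ) (v : V) : ℕ :=
  if Even t then (M.delta t v).max' (M.delta_nonempty t v)
  else (M.delta t v).min' (M.delta_nonempty t v)

end FactorGraphModel

namespace PackingProblem

variable {V C : Type*} [Fintype V] [Fintype C]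

/-- The feasible set of the packing LP. -/
def feasibleLP (P : PackingProblem V C) : Set (V → ℝ) :=
  {x | x ∈ rBox P.X ∧ ∀ c, (P.A.map (Nat.cast : ℕ → ℝ) *ᵥ x) c ≤ (P.b c : ℝ)}

/-- The set of optimal solutions of the packing LP, which maximizes the weight. -/
def optLP (P : PackingProblem V C) : Set (V → ℝ) :=
  {x | x ∈ P.feasibleLP ∧ ∀ y ∈ P.feasibleLP, P.w ⬝ᵥ y ≤ P.w ⬝ᵥ x}

/-- The factor graph model of a packing problem. -/
def factorGraphModel (P : PackingProblem V C) : FactorGraphModel V C where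
  E := Finset.univ.filter fun e => P.A e.2 e.1 = 1
  ψ := fun c y =>
    if (∑ v ∈ Finset.univ.filter (fun v => P.A c v = 1), y v) ≤ P.b c then 0 else ⊥
  φ := fun v β => P.w v * (β : ℝ)
  X := P.X

end PackingProblem

end

/-! LP duality gives multipliers `l c` satisfying complementary slackness with `x`; they act as the
price of a unit of constraint `c`. The claim is that prices control message increments. After an
even number of iterations, raising `β < x v` by one lowers a message `c → v` by at most `l c`; after
an odd number, raising it to a value above `x v` lowers the message by at least `l c`. A constraint
vertex turns one statement into the other by exchanging a unit between `v` and another variable on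
the opposite side of `x` (`conMsg_le_succ`, `conMsg_succ_add_le`). Summed at `r` against `w r`, the
prices cancel: final values do not decrease up to the first integer above `x r` (even), or do not
increase beyond `x r` (odd). -/

/-! ### Feasible directions and Farkas' lemma -/

open Filter Topology in
theorem eventually_add_mul_le {a e B : ℝ} (h : a ≤ B) (he : a = B → e ≤ 0) :
    ∀ᶠ ε in 𝓝[>] (0 : ℝ), a + ε * e ≤ B := by
  rcases h.eq_or_lt with rfl | h
  · filter_upwards [self_mem_nhdsWithin] with ε hε
    have := mul_nonpos_of_nonneg_of_nonpos (le_of_lt hε) (he rfl)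
    linarith
  · have hc : Tendsto (fun ε : ℝ => a + ε * e) (𝓝 0) (𝓝 (a + 0 * e)) :=
      Continuous.tendsto (by fun_prop) 0
    have := (hc.eventually (eventually_lt_nhds (show a + 0 * e < B by simpa using h))).filter_mono
      (nhdsWithin_le_nhds (s := Set.Ioi 0))
    filter_upwards [this] with ε hε using hε.le

/-- **Farkas' lemma** for finitely many linear functionals. -/
theorem exists_nonneg_combination_of_forall_nonpos {E ι : Type*} [AddCommGroup E] [Module ℝ E]
    (s : Finset ι) (f : ι → E →ₗ[ℝ] ℝ) (g : E →ₗ[ℝ] ℝ)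
    (h : ∀ d, (∀ i ∈ s, f i d ≤ 0) → g d ≤ 0) :
    ∃ c : ι → ℝ, (∀ i, 0 ≤ c i) ∧ ∀ d, g d = ∑ i ∈ s, c i * f i d := by
  classical
  induction s using Finset.induction_on generalizing f g with
  | empty =>
    refine ⟨0, fun _ => le_rfl, fun d => ?_⟩
    have h1 := h d (by simp)
    have h2 := h (-d) (by simp)
    rw [map_neg] at h2
    simp only [Finset.sum_empty]
    linarith
  | insert a s ha ih =>
    by_cases hs : ∀ d, (∀ i ∈ s, f i d ≤ 0) → g d ≤ 0
    · obtain ⟨c, hc, hg⟩ := ih f g hs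
      refine ⟨Function.update c a 0, fun i => ?_, fun d => ?_⟩
      · by_cases hi : i = a
        · simp [hi]
        · simpa [hi] using hc i
      · rw [Finset.sum_insert ha, hg d]
        simp only [Function.update_self, zero_mul, zero_add]
        refine Finset.sum_congr rfl fun i hi => ?_
        rw [Function.update_of_ne (ne_of_mem_of_not_mem hi ha)]
    · push Not at hs
      obtain ⟨d₀, hd₀, hgd₀⟩ := hs
      have hpos : 0 < f a d₀ := by
        by_contra hn
        refine absurd (h d₀ fun i hi => ?_) (not_le.2 hgd₀)
        rcases Finset.mem_insert.1 hi with rfl | hi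
        · exact not_lt.1 hn
        · exact hd₀ i hi
      set k := (f a d₀)⁻¹ with hk
      have hk0 : 0 < k := inv_pos.2 hpos
      have hka : k * f a d₀ = 1 := inv_mul_cancel₀ hpos.ne'
      -- The corrected functionals vanish at `d₀`: this projects along `d₀` onto the kernel of `f
      -- a`.
      obtain ⟨c, hc, hg⟩ := ih (fun i => f i - (k * f i d₀) • f a) (g - (k * g d₀) • f a)
        (fun d hd => by
          have := h (d - (k * f a d) • d₀) fun i hi => by
            rcases Finset.mem_insert.1 hi with rfl | hi
            · simp only [map_sub, map_smul, smul_eq_mul]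
              have : k * f i d * f i d₀ = f i d := by
                rw [mul_right_comm, hka, one_mul]
              linarith
            · have := hd i hi
              simp only [LinearMap.sub_apply, LinearMap.smul_apply, smul_eq_mul, map_sub,
                map_smul] at this ⊢
              linarith
          simp only [LinearMap.sub_apply, LinearMap.smul_apply, smul_eq_mul, map_sub,
                map_smul] at this ⊢
          linarith)
      refine ⟨Function.update c a (k * g d₀ - ∑ i ∈ s, c i * (k * f i d₀)), fun i => ?_,
        fun d => ?_⟩
      · by_cases hi : i = a
        · subst hi
          rw [Function.update_self]
          have h1 : ∑ j ∈ s, c j * (k * f j d₀) ≤ 0 := Finset.sum_nonpos fun j hj =>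
            mul_nonpos_of_nonneg_of_nonpos (hc j)
              (mul_nonpos_of_nonneg_of_nonpos hk0.le (hd₀ j hj))
          have := mul_pos hk0 hgd₀
          linarith
        · simpa [hi] using hc i
      · have h1 := hg d
        simp only [LinearMap.sub_apply, LinearMap.smul_apply, smul_eq_mul, mul_sub,
          Finset.sum_sub_distrib] at h1
        rw [Finset.sum_insert ha, Function.update_self, sub_mul, Finset.sum_mul]
        have h2 : ∑ i ∈ s, Function.update c a (k * g d₀ - ∑ i ∈ s, c i * (k * f i d₀)) i * f i d
            = ∑ i ∈ s, c i * f i d := Finset.sum_congr rfl fun i hi => by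
          rw [Function.update_of_ne (ne_of_mem_of_not_mem hi ha)]
        have h3 : ∑ i ∈ s, c i * (k * f i d₀ * f a d) = ∑ i ∈ s, c i * (k * f i d₀) * f a d :=
          Finset.sum_congr rfl fun i _ => by ring
        rw [h2]
        linarith

/-! ### Increments of sums with values in `WithBot ℝ` -/

theorem mem_zBox {V : Type*} [Fintype V] [DecidableEq V] {X z : V → ℕ} : z ∈ zBox X ↔ ∀ v, z v ≤ X v := by
  simp [zBox]

/-- Here `κ` is the price of the edge left out of `S`: `l c` for a message to `c`, zero for a final
value. -/
theorem weight_add_sum_le_succ {C : Type*} {μ : C → ℕ → WithBot ℝ} {l : C → ℝ} {S : Finset C} {κ w : ℝ}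
    {β : ℕ} (hμ : ∀ c ∈ S, μ c β ≤ μ c (β + 1) + (l c : ℝ)) (hw : ∑ c ∈ S, l c + κ ≤ w) :
    ((w * β : ℝ) : WithBot ℝ) + ∑ c ∈ S, μ c β + (κ : ℝ) ≤
      ((w * (β + 1 : ℕ) : ℝ) : WithBot ℝ) + ∑ c ∈ S, μ c (β + 1) := by
  have h1 := Finset.sum_le_sum hμ
  rw [Finset.sum_add_distrib, ← WithBot.coe_sum] at h1
  calc _ ≤ ((w * β : ℝ) : WithBot ℝ) + (∑ c ∈ S, μ c (β + 1) + ((∑ c ∈ S, l c : ℝ) : WithBot ℝ))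
          + (κ : ℝ) := by gcongr
    _ = ((w * β + (∑ c ∈ S, l c + κ) : ℝ) : WithBot ℝ) + ∑ c ∈ S, μ c (β + 1) := by
        push_cast; abel
    _ ≤ _ := by
        gcongr
        refine WithBot.coe_le_coe.2 ?_
        push_cast
        linarith

theorem weight_add_sum_succ_le {C : Type*} {μ : C → ℕ → WithBot ℝ} {l : C → ℝ} {S : Finset C} {κ w : ℝ}
    {β : ℕ} (hμ : ∀ c ∈ S, μ c (β + 1) + (l c : ℝ) ≤ μ c β) (hw : w ≤ ∑ c ∈ S, l c + κ) :
    ((w * (β + 1 : ℕ) : ℝ) : WithBot ℝ) + ∑ c ∈ S, μ c (β + 1) ≤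
      ((w * β : ℝ) : WithBot ℝ) + ∑ c ∈ S, μ c β + (κ : ℝ) := by
  have h1 := Finset.sum_le_sum hμ
  rw [Finset.sum_add_distrib, ← WithBot.coe_sum] at h1
  calc _ ≤ ((w * β + (∑ c ∈ S, l c + κ) : ℝ) : WithBot ℝ) + ∑ c ∈ S, μ c (β + 1) := by
        gcongr
        refine WithBot.coe_le_coe.2 ?_
        push_cast
        linarith
    _ = ((w * β : ℝ) : WithBot ℝ) + (∑ c ∈ S, μ c (β + 1) + ((∑ c ∈ S, l c : ℝ) : WithBot ℝ))
          + (κ : ℝ) := by push_cast; abel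
    _ ≤ _ := by gcongr

theorem sum_add_le_sum_add {V : Type*} [DecidableEq V] {S : Finset V} {f g : V → WithBot ℝ} {u : V} {a b : WithBot ℝ}
    (hu : u ∈ S) (h : ∀ i ∈ S, i ≠ u → f i = g i) (hab : f u + a ≤ g u + b) :
    ∑ i ∈ S, f i + a ≤ ∑ i ∈ S, g i + b := by
  rw [← Finset.sum_erase_add _ _ hu, ← Finset.sum_erase_add _ g hu, add_assoc, add_assoc,
    Finset.sum_congr rfl fun i hi => h i (Finset.mem_of_mem_erase hi) (Finset.ne_of_mem_erase hi)]
  gcongr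

/-! ### Complementary slackness -/

namespace PackingProblem

open scoped Matrix

variable {V C : Type*}

/-- Dual multipliers of the constraints that satisfy complementary slackness with `x`. -/
structure IsDualFor [Fintype V] [Fintype C] (P : PackingProblem V C) (x : V → ℝ) (l : C → ℝ) : Prop where
  nonneg : ∀ c, 0 ≤ l c
  tight : ∀ c, 0 < l c → ∑ v with P.A c v = 1, x v = P.b c
  le_of_lt : ∀ v, x v < P.X v → P.w v ≤ ∑ c with P.A c v = 1, l c
  ge_of_pos : ∀ v, 0 < x v → ∑ c with P.A c v = 1, l c ≤ P.w v

theorem mulVec_eq_sum_filter [Fintype V] (P : PackingProblem V C) (x : V → ℝ) (c : C) :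
    (P.A.map (Nat.cast : ℕ → ℝ) *ᵥ x) c = ∑ v with P.A c v = 1, x v := by
  rw [Finset.sum_filter]
  refine Finset.sum_congr rfl fun v _ => ?_
  rcases P.zero_one c v with h | h <;> simp [h]

variable [Fintype V] [Fintype C]

theorem exists_isDualFor (P : PackingProblem V C) {x : V → ℝ} (hx : x ∈ P.optLP) :
    ∃ l, P.IsDualFor x l := by
  classical
  obtain ⟨⟨hbox, hcon⟩, hopt⟩ := hx
  simp only [mulVec_eq_sum_filter] at hcon
  let f : C ⊕ V ⊕ V → (V → ℝ) →ₗ[ℝ] ℝ := Sum.elim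
    (fun c => ∑ v with P.A c v = 1, LinearMap.proj v)
    (Sum.elim (fun v => LinearMap.proj v) (fun v => -LinearMap.proj v))
  let s : Finset (C ⊕ V ⊕ V) := Finset.univ.filter (Sum.elim
    (fun c => ∑ v with P.A c v = 1, x v = P.b c)
    (Sum.elim (fun v => x v = P.X v) (fun v => x v = 0)))
  let g : (V → ℝ) →ₗ[ℝ] ℝ := ∑ v, P.w v • LinearMap.proj v
  have hg : ∀ d, g d = P.w ⬝ᵥ d := fun d => by simp [g, dotProduct]
  obtain ⟨c, hc, hgc⟩ := exists_nonneg_combination_of_forall_nonpos s f g fun d hd => by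
    have h1 : ∀ c, ∑ v with P.A c v = 1, x v = P.b c → ∑ v with P.A c v = 1, d v ≤ 0 :=
      fun c h => by simpa [f] using hd (.inl c) (by simp [s, h])
    have h2 : ∀ v, x v = P.X v → d v ≤ 0 :=
      fun v h => by simpa [f] using hd (.inr (.inl v)) (by simp [s, h])
    have h3 : ∀ v, x v = 0 → 0 ≤ d v :=
      fun v h => by simpa [f] using hd (.inr (.inr v)) (by simp [s, h])
    have e1 := Filter.eventually_all.2 fun c => eventually_add_mul_le (hcon c) (h1 c)
    have e2 := Filter.eventually_all.2 fun v => eventually_add_mul_le (hbox v).2 (h2 v)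
    have e3 := Filter.eventually_all.2 fun v =>
      eventually_add_mul_le (a := -x v) (e := -d v) (B := 0) (by linarith [(hbox v).1])
        fun h => by linarith [h3 v (by linarith)]
    obtain ⟨ε, ⟨⟨e1, e2⟩, e3⟩, hε⟩ := ((e1.and e2).and e3).and self_mem_nhdsWithin |>.exists
    -- A short step along `d` stays feasible, so optimality forces `g d ≤ 0`.
    have hy := hopt (x + ε • d) ⟨fun v => ⟨?_, ?_⟩, fun c => ?_⟩
    · rw [dotProduct_add, dotProduct_smul, smul_eq_mul] at hy
      rw [hg]
      exact nonpos_of_mul_nonpos_right (by linarith) hε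
    · have := e3 v
      simp only [Pi.add_apply, Pi.smul_apply, smul_eq_mul]
      linarith
    · exact e2 v
    · rw [mulVec_eq_sum_filter]
      simp only [Pi.add_apply, Pi.smul_apply, smul_eq_mul, Finset.sum_add_distrib,
        ← Finset.mul_sum]
      exact e1 c
  let l : C → ℝ := fun k => if ∑ v with P.A k v = 1, x v = P.b k then c (.inl k) else 0
  -- Farkas' identity evaluated at a unit vector; the bound multipliers survive only where the bound
  -- is tight.
  have hw : ∀ v, P.w v = ∑ k with P.A k v = 1, l k + (if x v = P.X v then c (.inr (.inl v)) else 0)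
      - (if x v = 0 then c (.inr (.inr v)) else 0) := fun v => by
    have := hgc (Pi.single v 1)
    rw [hg, Finset.sum_filter, Fintype.sum_sum_type, Fintype.sum_sum_type] at this
    simp only [dotProduct_single, mul_one] at this
    rw [this, add_sub_assoc]
    congr 1
    · rw [Finset.sum_filter]
      refine Finset.sum_congr rfl fun k _ => ?_
      simp only [f, l, Sum.elim_inl, LinearMap.sum_apply, LinearMap.proj_apply]
      by_cases h : P.A k v = 1 <;> simp [Pi.single_apply, h]
    · rw [sub_eq_add_neg]
      congr 1
      · rw [Finset.sum_eq_single v] <;> simp +contextual [f]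
      · rw [Finset.sum_eq_single v] <;> simp +contextual [f, neg_ite]
  refine ⟨l, fun k => ?_, fun k hk => ?_, fun v hv => ?_, fun v hv => ?_⟩
  · simp only [l]
    split_ifs
    exacts [hc _, le_rfl]
  · by_contra h
    simp [l, h] at hk
  · have := hw v
    rw [if_neg hv.ne] at this
    split_ifs at this
    · linarith [hc (.inr (.inr v))]
    · linarith
  · have := hw v
    rw [if_neg hv.ne'] at this
    split_ifs at this
    · linarith [hc (.inr (.inl v))]
    · linarith

variable [DecidableEq V] [DecidableEq C] (P : PackingProblem V C)

theorem mem_nbrV {v : V} {c : C} : c ∈ P.factorGraphModel.nbrV v ↔ P.A c v = 1 := by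
  simp [FactorGraphModel.nbrV, factorGraphModel]

theorem nbrV_eq (v : V) : P.factorGraphModel.nbrV v = Finset.univ.filter (P.A · v = 1) := by
  ext; simp [mem_nbrV]

theorem nbrC_eq (c : C) : P.factorGraphModel.nbrC c = Finset.univ.filter (P.A c · = 1) := by
  ext; simp [FactorGraphModel.nbrC, factorGraphModel]

theorem psi_eq_zero_iff {c : C} {z : V → ℕ} :
    P.factorGraphModel.ψ c z = 0 ↔ ∑ v ∈ P.factorGraphModel.nbrC c, z v ≤ P.b c := by
  rw [nbrC_eq]
  simp [factorGraphModel]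

/-! ### Propagation of the increment bounds -/

variable {P} {x : V → ℝ} {l : C → ℝ}

theorem IsDualFor.varMsg_add_le (hl : P.IsDualFor x l) {μ : C → V → ℕ → WithBot ℝ} {v : V}
    (hμ : ∀ c, P.A c v = 1 → ∀ β : ℕ, (β : ℝ) < x v → μ c v β ≤ μ c v (β + 1) + (l c : ℝ))
    {c : C} (hc : P.A c v = 1) {β : ℕ} (hβ : (β : ℝ) < x v) :
    P.factorGraphModel.varMsg μ v c β + (l c : ℝ) ≤ P.factorGraphModel.varMsg μ v c (β + 1) := by
  refine weight_add_sum_le_succ (μ := fun c => μ c v)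
    (fun c' hc' => hμ c' (P.mem_nbrV.1 (Finset.mem_of_mem_erase hc')) β hβ) ?_
  rw [Finset.sum_erase_add _ _ (P.mem_nbrV.2 hc), nbrV_eq]
  exact hl.ge_of_pos v (β.cast_nonneg.trans_lt hβ)

theorem IsDualFor.varMsg_succ_le (hl : P.IsDualFor x l) {μ : C → V → ℕ → WithBot ℝ} {v : V}
    (hμ : ∀ c, P.A c v = 1 → ∀ β : ℕ, x v < (β + 1 : ℕ) → μ c v (β + 1) + (l c : ℝ) ≤ μ c v β)
    {c : C} (hc : P.A c v = 1) {β : ℕ} (hβ : x v < (β + 1 : ℕ)) (hX : β + 1 ≤ P.X v) :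
    P.factorGraphModel.varMsg μ v c (β + 1) ≤ P.factorGraphModel.varMsg μ v c β + (l c : ℝ) := by
  refine weight_add_sum_succ_le (μ := fun c => μ c v)
    (fun c' hc' => hμ c' (P.mem_nbrV.1 (Finset.mem_of_mem_erase hc')) β hβ) ?_
  rw [Finset.sum_erase_add _ _ (P.mem_nbrV.2 hc), nbrV_eq]
  exact hl.le_of_lt v (hβ.trans_le (by exact_mod_cast hX))

theorem le_conMsg {ν : V → C → ℕ → WithBot ℝ} {c : C} {v : V} {β : ℕ} {z : V → ℕ}
    (hX : ∀ u, z u ≤ P.X u) (hv : z v = β) (hb : ∑ u ∈ P.factorGraphModel.nbrC c, z u ≤ P.b c) :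
    ∑ u ∈ (P.factorGraphModel.nbrC c).erase v, ν u c (z u) ≤ P.factorGraphModel.conMsg ν c v β := by
  classical
  unfold FactorGraphModel.conMsg
  refine Finset.le_sup (f := fun z : V → ℕ => ∑ u ∈ (P.factorGraphModel.nbrC c).erase v, ν u c (z u))
    (Finset.mem_filter.2 ⟨mem_zBox.2 hX, hv, P.psi_eq_zero_iff.2 hb⟩)

theorem conMsg_add_le {ν : V → C → ℕ → WithBot ℝ} {c : C} {v : V} {β : ℕ} {k : ℝ} {B : WithBot ℝ}
    (h : ∀ z : V → ℕ, (∀ u, z u ≤ P.X u) → z v = β →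
      ∑ u ∈ P.factorGraphModel.nbrC c, z u ≤ P.b c →
      ∑ u ∈ (P.factorGraphModel.nbrC c).erase v, ν u c (z u) + (k : WithBot ℝ) ≤ B) :
    P.factorGraphModel.conMsg ν c v β + (k : WithBot ℝ) ≤ B := by
  classical
  unfold FactorGraphModel.conMsg
  rcases Finset.eq_empty_or_nonempty ((zBox P.factorGraphModel.X).filter
    fun z => z v = β ∧ P.factorGraphModel.ψ c z = 0) with he | hne
  · convert (bot_le : ⊥ ≤ B)
    rw [WithBot.add_eq_bot]
    left
    convert Finset.sup_empty
  · obtain ⟨z, hz, he⟩ := Finset.exists_mem_eq_sup _ hne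
      (fun z : V → ℕ => ∑ u ∈ (P.factorGraphModel.nbrC c).erase v, ν u c (z u))
    obtain ⟨h1, h2, h3⟩ := Finset.mem_filter.1 hz
    convert h z (mem_zBox.1 h1) h2 (P.psi_eq_zero_iff.1 h3) using 2

/-- Raise `z v` by one. If this breaks the constraint, `z` was tight, and `z v < x v` forces `x u <
z u` for some other `u`; taking the unit from `u` costs at most `l c`. -/
theorem conMsg_le_succ (hl : ∀ c, 0 ≤ l c) {ν : V → C → ℕ → WithBot ℝ} {c : C}
    (hx0 : ∀ v, 0 ≤ x v)
    (hbox : ∀ v, x v ≤ P.X v) (hcon : ∑ v with P.A c v = 1, x v ≤ P.b c)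
    (hν : ∀ u, P.A c u = 1 → ∀ β : ℕ, x u < (β + 1 : ℕ) → β + 1 ≤ P.X u →
      ν u c (β + 1) ≤ ν u c β + (l c : ℝ)) {v : V} (hv : P.A c v = 1) {β : ℕ} (hβ : β < x v) :
    P.factorGraphModel.conMsg ν c v β ≤ P.factorGraphModel.conMsg ν c v (β + 1) + (l c : ℝ) := by
  have hvc : v ∈ P.factorGraphModel.nbrC c := by simp [nbrC_eq, hv]
  have hvX : β + 1 ≤ P.X v := by exact_mod_cast hβ.trans_le (hbox v)
  rw [← add_zero (P.factorGraphModel.conMsg ν c v β), ← WithBot.coe_zero]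
  refine conMsg_add_le fun z hzX hzv hzb => ?_
  rcases hzb.lt_or_eq with hlt | heq
  · have := le_conMsg (P := P) (ν := ν) (c := c) (v := v) (β := β + 1) (z := z + Pi.single v 1)
      (fun u => by
        by_cases hu : u = v
        · subst hu; simpa [hzv] using hvX
        · simpa [hu] using hzX u) (by simp [hzv])
      (by simpa [Finset.sum_add_distrib, Finset.sum_pi_single', hvc] using hlt)
    rw [Finset.sum_congr (g := fun u => ν u c (z u)) rfl fun u hu => by
      simp [Finset.ne_of_mem_erase hu]] at this
    exact add_le_add this (WithBot.coe_le_coe.2 (hl c))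
  · obtain ⟨u, hu, hxu⟩ : ∃ u ∈ P.factorGraphModel.nbrC c, x u < z u := by
      by_contra! hcontra
      have := Finset.sum_lt_sum hcontra ⟨v, hvc, by rwa [hzv]⟩
      rw [← Nat.cast_sum, heq, nbrC_eq] at this
      linarith
    have huv : u ≠ v := by
      rintro rfl
      rw [hzv] at hxu
      exact lt_asymm hxu hβ
    have hAu : P.A c u = 1 := by simpa [nbrC_eq] using hu
    -- Truncated subtraction is harmless because `z u > x u ≥ 0`.
    obtain ⟨y, rfl⟩ : ∃ y, z = y + Pi.single u 1 := ⟨z - Pi.single u 1, by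
      have hpos : 0 < z u := by
        by_contra h0
        rw [Nat.eq_zero_of_not_pos h0] at hxu
        exact absurd hxu (not_lt.2 (by simpa using hx0 u))
      ext i
      by_cases hi : i = u
      · subst hi; simp; lia
      · simp [hi]⟩
    have hyv : y v = β := by simpa [huv.symm] using hzv
    have hyX : ∀ i, y i ≤ P.X i := fun i => le_trans (by simp) (hzX i)
    have hyu : y u + 1 ≤ P.X u := by simpa using hzX u
    refine le_trans ?_ (add_le_add_left (le_conMsg (z := y + Pi.single v 1) (fun i => ?_) ?_ ?_) _)
    · refine sum_add_le_sum_add (Finset.mem_erase.2 ⟨huv, hu⟩)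
        (fun i hi hiu => by simp [hiu, Finset.ne_of_mem_erase hi]) ?_
      simpa [huv] using hν u hAu (y u) (by simpa using hxu) hyu
    · by_cases hi : i = v
      · subst hi; simpa [hyv] using hvX
      · simpa [hi] using hyX i
    · simp [hyv]
    · rw [← heq]
      simp [Finset.sum_add_distrib, Finset.sum_pi_single', hu, hvc]

/-- Lower `z v` by one. If `l c > 0`, then `x` is tight at `c`, so `z v > x v` forces `z u < x u`
for some other `u`; giving the unit to `u` gains at least `l c`. -/
theorem conMsg_succ_add_le (hl : ∀ c, 0 ≤ l c) {ν : V → C → ℕ → WithBot ℝ} {c : C}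
    (hbox : ∀ v, x v ≤ P.X v) (hcon : 0 < l c → ∑ v with P.A c v = 1, x v = P.b c)
    (hν : ∀ u, P.A c u = 1 → ∀ β : ℕ, β < x u → ν u c β + (l c : ℝ) ≤ ν u c (β + 1))
    {v : V} (hv : P.A c v = 1) {β : ℕ} (hβ : x v < (β + 1 : ℕ)) :
    P.factorGraphModel.conMsg ν c v (β + 1) + (l c : ℝ) ≤ P.factorGraphModel.conMsg ν c v β := by
  have hvc : v ∈ P.factorGraphModel.nbrC c := by simp [nbrC_eq, hv]
  refine conMsg_add_le fun z hzX hzv hzb => ?_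
  obtain ⟨y, rfl⟩ : ∃ y, z = y + Pi.single v 1 := ⟨z - Pi.single v 1, by
    ext i
    by_cases hi : i = v
    · subst hi; simp [hzv]
    · simp [hi]⟩
  have hyv : y v = β := by simpa using hzv
  have hyX : ∀ i, y i ≤ P.X i := fun i => le_trans (by simp) (hzX i)
  have hyb : ∑ u ∈ P.factorGraphModel.nbrC c, y u + 1 ≤ P.b c := by
    simpa [Finset.sum_add_distrib, Finset.sum_pi_single', hvc] using hzb
  rw [Finset.sum_congr (g := fun u => ν u c (y u)) rfl fun u hu => by
      simp [Finset.ne_of_mem_erase hu]]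
  rcases (hl c).eq_or_lt with h0 | h0
  · rw [← h0, WithBot.coe_zero, add_zero]
    exact le_conMsg hyX hyv (by lia)
  · obtain ⟨u, hu, hxu⟩ : ∃ u ∈ P.factorGraphModel.nbrC c,
        (((y + Pi.single v 1 : V → ℕ) u : ℕ) : ℝ) < x u := by
      by_contra! hcontra
      have := Finset.sum_lt_sum hcontra ⟨v, hvc, by rwa [hzv]⟩
      rw [← Nat.cast_sum, nbrC_eq, hcon h0, ← nbrC_eq] at this
      exact absurd hzb (not_le.2 (by exact_mod_cast this))
    have huv : u ≠ v := by
      rintro rfl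
      rw [hzv] at hxu
      exact lt_asymm hxu hβ
    have hAu : P.A c u = 1 := by simpa [nbrC_eq] using hu
    replace hxu : (y u : ℝ) < x u := by simpa [huv] using hxu
    have huX : y u + 1 ≤ P.X u := by exact_mod_cast hxu.trans_le (hbox u)
    refine le_trans ?_ (le_conMsg (z := y + Pi.single u 1) (fun i => ?_) ?_ ?_)
    · refine le_of_le_of_eq ?_ (add_zero _)
      refine sum_add_le_sum_add (Finset.mem_erase.2 ⟨huv, hu⟩) (fun i _ hi => by simp [hi]) ?_
      simpa using hν u hAu (y u) hxu
    · by_cases hi : i = u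
      · subst hi; simpa using huX
      · simpa [hi] using hyX i
    · simp [huv.symm, hyv]
    · simpa [Finset.sum_add_distrib, Finset.sum_pi_single', hu] using hyb

/-- Both parities go into one induction, as each feeds the other. Zero messages satisfy the even
bound because `l c ≥ 0`. -/
theorem IsDualFor.msg_le (hl : P.IsDualFor x l) (hx : x ∈ P.feasibleLP) (t : ℕ) {c : C} {v : V}
    (hv : P.A c v = 1) (β : ℕ) :
    (Even t → β < x v → P.factorGraphModel.msg t c v β ≤
      P.factorGraphModel.msg t c v (β + 1) + (l c : ℝ)) ∧
    (Odd t → x v < (β + 1 : ℕ) → P.factorGraphModel.msg t c v (β + 1) + (l c : ℝ) ≤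
      P.factorGraphModel.msg t c v β) := by
  induction t generalizing c v β with
  | zero =>
    refine ⟨fun _ _ => ?_, by simp⟩
    simpa [FactorGraphModel.msg] using hl.nonneg c
  | succ t ih =>
    refine ⟨fun ht hβ => ?_, fun ht hβ => ?_⟩
    · refine conMsg_le_succ hl.nonneg (fun v => (hx.1 v).1) (fun v => (hx.1 v).2)
        (by simpa only [mulVec_eq_sum_filter] using hx.2 c) (fun u hu γ hγ hX => ?_) hv hβ
      exact hl.varMsg_succ_le (fun c' hc' γ => (ih hc' γ).2 (by grind)) hu hγ hX
    · refine conMsg_succ_add_le hl.nonneg (fun v => (hx.1 v).2) (hl.tight c)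
        (fun u hu γ hγ => ?_) hv hβ
      exact hl.varMsg_add_le (fun c' hc' γ => (ih hc' γ).1 (by grind)) hu hγ

theorem IsDualFor.finalValue_le_succ (hl : P.IsDualFor x l) (hx : x ∈ P.feasibleLP) {t : ℕ}
    (ht : Even t) {v : V} {β : ℕ} (hβ : β < x v) :
    P.factorGraphModel.finalValue t v β ≤ P.factorGraphModel.finalValue t v (β + 1) := by
  refine le_of_eq_of_le (add_zero _).symm (weight_add_sum_le_succ (κ := 0)
    (μ := fun c => P.factorGraphModel.msg t c v)
    (fun c hc => (hl.msg_le hx t (P.mem_nbrV.1 hc) β).1 ht hβ) ?_)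
  rw [nbrV_eq, add_zero]
  exact hl.ge_of_pos v (β.cast_nonneg.trans_lt hβ)

theorem IsDualFor.finalValue_succ_le (hl : P.IsDualFor x l) (hx : x ∈ P.feasibleLP) {t : ℕ}
    (ht : Odd t) {v : V} {β : ℕ} (hβ : x v < (β + 1 : ℕ)) (hX : β + 1 ≤ P.X v) :
    P.factorGraphModel.finalValue t v (β + 1) ≤ P.factorGraphModel.finalValue t v β := by
  refine le_of_le_of_eq (weight_add_sum_succ_le (κ := 0)
    (μ := fun c => P.factorGraphModel.msg t c v)
    (fun c hc => (hl.msg_le hx t (P.mem_nbrV.1 hc) β).2 ht hβ) ?_) (add_zero _)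
  rw [nbrV_eq, add_zero]
  exact hl.le_of_lt v (hβ.trans_le (by exact_mod_cast hX))

end PackingProblem

namespace FactorGraphModel

variable {V C : Type*} [Fintype V] [Fintype C] [DecidableEq V] [DecidableEq C]
  {M : FactorGraphModel V C} {t : ℕ} {v : V} {β γ : ℕ}

theorem mem_delta : β ∈ M.delta t v ↔ β ≤ M.X v ∧ M.finalValue t v β = M.maxValue t v := by
  simp [delta]

theorem mem_delta_of_le (hβ : β ∈ M.delta t v) (hγ : γ ≤ M.X v)
    (h : M.finalValue t v β ≤ M.finalValue t v γ) : γ ∈ M.delta t v := by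
  refine mem_delta.2 ⟨hγ, le_antisymm ?_ ((mem_delta.1 hβ).2 ▸ h)⟩
  exact Finset.le_sup (f := fun β => M.finalValue t v β)
    (Finset.mem_range.2 (Nat.lt_succ_of_le hγ))

end FactorGraphModel

theorem mainTheorem2 {V C : Type*} [Fintype V] [Fintype C] [DecidableEq V] [DecidableEq C]
    (P : PackingProblem V C) (r : V) (x : V → ℝ) (hx : x ∈ P.optLP)
    (hr : ¬ ∃ k : ℤ, x r = (k : ℝ)) (t : ℕ) :
    (Even t → ⌈x r⌉ ≤ (P.factorGraphModel.minSumPacking t r : ℤ)) ∧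
      (Odd t → (P.factorGraphModel.minSumPacking t r : ℤ) ≤ ⌊x r⌋) := by
  obtain ⟨l, hl⟩ := P.exists_isDualFor hx
  refine ⟨fun ht => ?_, fun ht => ?_⟩
  · rw [FactorGraphModel.minSumPacking, if_pos ht]
    set β := (P.factorGraphModel.delta t r).max' (P.factorGraphModel.delta_nonempty t r)
    by_contra! hlt
    have hlt : (β : ℝ) < x r := by simpa using Int.lt_ceil.1 hlt
    have hX : β + 1 ≤ P.X r := by exact_mod_cast hlt.trans_le (hx.1.1 r).2
    -- The successor would also be a maximizer, contradicting the choice of the largest.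
    have hmem := FactorGraphModel.mem_delta_of_le (Finset.max'_mem _ _) hX
      (hl.finalValue_le_succ hx.1 ht hlt)
    have := Finset.le_max' _ _ hmem
    lia
  · rw [FactorGraphModel.minSumPacking, if_neg (Nat.not_even_iff_odd.2 ht)]
    have hmin := (P.factorGraphModel.delta t r).min'_mem (P.factorGraphModel.delta_nonempty t r)
    have hle : ∀ k ∈ P.factorGraphModel.delta t r, (P.factorGraphModel.delta t r).min'
        (P.factorGraphModel.delta_nonempty t r) ≤ k := fun k => Finset.min'_le _ k
    generalize (P.factorGraphModel.delta t r).min' (P.factorGraphModel.delta_nonempty t r) = β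
      at hmin hle ⊢
    by_contra! hlt
    have hlt : x r < (β : ℝ) := by simpa using Int.floor_lt.1 hlt
    -- The minimizer of `delta` exceeds `x r ≥ 0`, so it has a predecessor, which is then a smaller
    -- maximizer.
    obtain ⟨γ, rfl⟩ : ∃ γ, β = γ + 1 := Nat.exists_eq_succ_of_ne_zero fun h => by
      rw [h, Nat.cast_zero] at hlt
      exact absurd (hx.1.1 r).1 (not_le.2 hlt)
    have hX : γ + 1 ≤ P.X r := (FactorGraphModel.mem_delta.1 hmin).1
    have := hle _ (FactorGraphModel.mem_delta_of_le hmin (by lia : γ ≤ P.X r)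
      (hl.finalValue_succ_le hx.1 ht hlt hX))
    lia
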